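/- Theorem 2. For every $\varepsilon>0$ there is a constant $c>0$, depending only on $\varepsilon$, such that for all integers $1\le K\le n$ the following holds. Consider the problem of maximizing a monotone submodular function $f\colon 2^E\to\mathbb{R}_+$ over the independent sets of a partition matroid of rank $K$ on $E=\{e_1,\dots,e_n\}$: $E$ is partitioned into $K$ non-empty classes, and a set is independent if it contains at most one element of each class. In the element-store model, a single-pass streaming algorithm maintains a set $S\subseteq E$ of stored elements, initially empty, and a memory $M$ of words; when $e_t$ arrives ($t=1,\dots,n$), it replaces $S$ by a subset of $S\cup\{e_t\}$ and updates $M$, using only $S$, the content of $M$, the partition (which may be known in advance) and the values $f(S')$ for $S'\subseteq S\cup\{e_t\}$ (elements are identified only by their arrival time and their class; computation is unbounded); after the last step it outputs a subset of $S$. Its space is the maximum number of words stored in $M$ plus the maximum size of $S$. Then any randomized algorithm of this kind (a probability distribution over deterministic ones) that on every such instance outputs an independent set of expected value at least $\frac{K}{2K-1}+\varepsilon$ times the optimal value uses, on some instance and with positive probability, space at least $c\,n/K$. That is, approximation ratio $\frac{K}{2K-1}+\varepsilon$ requires $\Omega(n/K)$ space. -/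

import Mathlib

open MeasureTheory

/-! Streams of length `n`: the ground set is `Fin n`, and its elements arrive in the order
`0, 1, …, n - 1`. An element is thus named by its arrival time, and everything else about it is
hidden in the objective function, which ranges over all set functions on `Fin n`. -/

/-- Non-negative set functions. -/
def NonnegSetFun {n : ℕ} (f : Finset (Fin n) → ℝ) : Prop :=
  ∀ S, 0 ≤ f S

/-- Monotone set functions. -/
def MonotoneSetFun {n : ℕ} (f : Finset (Fin n) → ℝ) : Prop :=
  ∀ S T, S ⊆ T → f S ≤ f T

/-- Submodular set functions (diminishing marginal returns). -/
def SubmodularSetFun {n : ℕ} (f : Finset (Fin n) → ℝ) : Prop :=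
  ∀ S T, S ⊆ T → ∀ e, e ∉ T → f (insert e T) - f T ≤ f (insert e S) - f S

/-- Independence in the partition matroid whose classes are the fibres of `χ`: at most one
element is taken from each class. -/
def PartitionIndep {n K : ℕ} (χ : Fin n → Fin K) (T : Finset (Fin n)) : Prop :=
  ∀ x ∈ T, ∀ y ∈ T, χ x = χ y → x = y

/-- An instance of monotone submodular maximization under a partition matroid constraint of
rank `K`: all `K` classes are non-empty (so that the rank is exactly `K`), and the objective is a
non-negative monotone submodular function. -/
structure IsInstance {n K : ℕ} (χ : Fin n → Fin K) (f : Finset (Fin n) → ℝ) : Prop where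
  classes_nonempty : Function.Surjective χ
  nonneg : NonnegSetFun f
  monotone : MonotoneSetFun f
  submodular : SubmodularSetFun f

/-- The values `f S'` for `S' ⊆ V`; nothing is revealed about the other values of `f`. -/
noncomputable def visible {n : ℕ} (f : Finset (Fin n) → ℝ) (V : Finset (Fin n)) :
    Finset (Fin n) → ℝ :=
  fun S' => if S' ⊆ V then f S' else 0

/-- A deterministic single-pass streaming algorithm in the element-store model, for streams of
length `n` and partition matroids with `K` classes. It maintains a set `S` of stored elements and
a memory `M`, a list of words over an arbitrary alphabet `W`. Its computational power is
unbounded, and the partition `χ` is known to it from the start. The objective function is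
accessible only through the last argument of `keep`, `write` and `output`, to which the table of
the currently visible values is passed. -/
structure StreamingAlgorithm (n K : ℕ) (W : Type*) where
  /-- The initial content of the memory. -/
  init : (Fin n → Fin K) → List W
  /-- The new set of stored elements when element `t` arrives, given `S`, `M` and the values. -/
  keep : (Fin n → Fin K) → (t : Fin n) → (S : Finset (Fin n)) → (M : List W) →
    (Finset (Fin n) → ℝ) → Finset (Fin n)
  /-- The new content of the memory when element `t` arrives, given `S`, `M` and the values. -/
  write : (Fin n → Fin K) → (t : Fin n) → (S : Finset (Fin n)) → (M : List W) →
    (Finset (Fin n) → ℝ) → List W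
  /-- The output after the last step, given `S`, `M` and the values. -/
  output : (Fin n → Fin K) → (S : Finset (Fin n)) → (M : List W) →
    (Finset (Fin n) → ℝ) → Finset (Fin n)
  keep_subset : ∀ χ t S M v, keep χ t S M v ⊆ insert t S
  output_subset : ∀ χ S M v, output χ S M v ⊆ S

namespace StreamingAlgorithm

variable {n K : ℕ} {W : Type*}

/-- The pair `(S, M)` after the first `t` steps (for `t ≤ n`), starting from `S = ∅`. At a step
with arriving element `e` the values of `f` on the subsets of `S ∪ {e}` are visible. -/
noncomputable def state (A : StreamingAlgorithm n K W) (χ : Fin n → Fin K)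
    (f : Finset (Fin n) → ℝ) : ℕ → Finset (Fin n) × List W
  | 0 => (∅, A.init χ)
  | t + 1 =>
    if h : t < n then
      let S := (A.state χ f t).1
      let M := (A.state χ f t).2
      let v := visible f (insert ⟨t, h⟩ S)
      (A.keep χ ⟨t, h⟩ S M v, A.write χ ⟨t, h⟩ S M v)
    else A.state χ f t

/-- The output set, a subset of the set stored after the last step. -/
noncomputable def result (A : StreamingAlgorithm n K W) (χ : Fin n → Fin K)
    (f : Finset (Fin n) → ℝ) : Finset (Fin n) :=
  A.output χ (A.state χ f n).1 (A.state χ f n).2 (visible f (A.state χ f n).1)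

/-- The space used on an instance: the maximum number of words in `M` plus the maximum size
of `S`, over the course of the stream. -/
noncomputable def space (A : StreamingAlgorithm n K W) (χ : Fin n → Fin K)
    (f : Finset (Fin n) → ℝ) : ℕ :=
  (Finset.range (n + 1)).sup (fun t => (A.state χ f t).2.length) +
    (Finset.range (n + 1)).sup (fun t => (A.state χ f t).1.card)

end StreamingAlgorithm

/-! A randomized algorithm is a family `A ω` of deterministic algorithms whose seed `ω` is drawn
from a probability measure `μ`. -/

/-- On every instance, the output is feasible (almost surely) and its expected value is at least
`α` times the value of every feasible set, hence at least `α` times the optimal value. -/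
def HasApproxRatio {n K : ℕ} {W Ω : Type*} [MeasurableSpace Ω] (μ : Measure Ω)
    (A : Ω → StreamingAlgorithm n K W) (α : ℝ) : Prop :=
  ∀ (χ : Fin n → Fin K) (f : Finset (Fin n) → ℝ), IsInstance χ f →
    (∀ᵐ ω ∂μ, PartitionIndep χ ((A ω).result χ f)) ∧
    Integrable (fun ω => f ((A ω).result χ f)) μ ∧
    ∀ T, PartitionIndep χ T → α * f T ≤ ∫ ω, f ((A ω).result χ f) ∂μ

/-- On every instance, the algorithm uses (almost surely) space at most `s`. -/
def UsesSpaceAtMost {n K : ℕ} {W Ω : Type*} [MeasurableSpace Ω] (μ : Measure Ω)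
    (A : Ω → StreamingAlgorithm n K W) (s : ℕ) : Prop :=
  ∀ (χ : Fin n → Fin K) (f : Finset (Fin n) → ℝ), IsInstance χ f →
    ∀ᵐ ω ∂μ, (A ω).space χ f ≤ s

/-! With `K = k + 1`, take `k` blocks of length `m`, each hiding one special element at an arbitrary
position. In `hiddenObjective` the special element of block `i` saturates term `i` alone, while an
ordinary element of that block adds 1 to every term from `i` on. By `sum_min_add_one` both choices
have the same value until later blocks arrive (`hiddenObjective_update`). So the state at the end of
block `i` does not depend on the special position in that block. At most `s` elements are stored
then, so over random positions the special one survives with probability at most `s / m`; the memory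
cannot help, because outputs are subsets of the stored set. The special elements together with the
last element are worth `k * (2 * k + 1)`. A feasible set is worth at most `k * (k + 1)`, plus `2 *
k` per special element of a block that it contains (`hiddenObjective_le`). Averaging over positions
and seeds, a ratio of `(k + 1) / (2 * k + 1) + ε` forces `ε * m ≤ s`, with `m` of order `n / K`. -/

/-! ### Truncated additive functions -/

/-- The sum over `i < N` of the additive functions with weights `w i`, truncated at `N - i`. -/
def truncatedSum {n : ℕ} (N : ℕ) (w : ℕ → Fin n → ℕ) (S : Finset (Fin n)) : ℕ :=
  ∑ i ∈ Finset.range N, min (N - i) (∑ x ∈ S, w i x)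

theorem truncatedSum_mono {n : ℕ} (N : ℕ) (w : ℕ → Fin n → ℕ) {S T : Finset (Fin n)}
    (h : S ⊆ T) : truncatedSum N w S ≤ truncatedSum N w T :=
  Finset.sum_le_sum fun _ _ => min_le_min_left _ (Finset.sum_le_sum_of_subset h)

theorem truncatedSum_submodular {n : ℕ} (N : ℕ) (w : ℕ → Fin n → ℕ) {S T : Finset (Fin n)}
    (h : S ⊆ T) {e : Fin n} (he : e ∉ T) :
    truncatedSum N w (insert e T) + truncatedSum N w S ≤
      truncatedSum N w (insert e S) + truncatedSum N w T := by
  unfold truncatedSum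
  rw [← Finset.sum_add_distrib, ← Finset.sum_add_distrib]
  refine Finset.sum_le_sum fun i _ => ?_
  rw [Finset.sum_insert he, Finset.sum_insert fun h' => he (h h')]
  have : ∑ x ∈ S, w i x ≤ ∑ x ∈ T, w i x := Finset.sum_le_sum_of_subset h
  omega

theorem isInstance_truncatedSum {n K : ℕ} {χ : Fin n → Fin K} (hχ : Function.Surjective χ)
    (N : ℕ) (w : ℕ → Fin n → ℕ) : IsInstance χ fun S => (truncatedSum N w S : ℝ) where
  classes_nonempty := hχ
  nonneg _ := Nat.cast_nonneg _
  monotone _ _ h := Nat.cast_le.mpr (truncatedSum_mono N w h)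
  submodular S T h e he := by
    have : (truncatedSum N w (insert e T) : ℝ) + truncatedSum N w S ≤
        truncatedSum N w (insert e S) + truncatedSum N w T := by
      exact_mod_cast truncatedSum_submodular N w h he
    linarith

/-- The exchange identity behind the indistinguishability: on the left one more unit is added to
every term, on the right the first term is saturated and the others are left alone. -/
theorem sum_min_add_one (M q : ℕ) :
    ∑ j ∈ Finset.range (M + 1), min (M + 1 - j) (q + 1) =
      M + 1 + ∑ j ∈ Finset.range M, min (M - j) q := by
  have h : ∀ j ∈ Finset.range (M + 1), min (M + 1 - j) (q + 1) = min (M - j) q + 1 := by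
    intro j hj
    rw [Finset.mem_range] at hj
    omega
  rw [Finset.sum_congr rfl h, Finset.sum_add_distrib, Finset.sum_range_succ]
  simp
  omega

/-! ### The hard instances

The first `k * m` elements form `k` blocks of length `m`, which are the first `k` classes; the
remaining elements form the last class. Block `i` hides the special element `i * m + p i`. -/

/-- The class of an element. -/
def blockClass (n k m : ℕ) (x : Fin n) : Fin (k + 1) :=
  ⟨min (x.val / m) k, Nat.lt_succ_of_le (min_le_right _ _)⟩

/-- The special element of block `i`, or the last element of the stream for `i ≥ k`. -/
def special (n : ℕ) {k m : ℕ} (p : Fin k → Fin m) (i : ℕ) : ℕ :=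
  if h : i < k then i * m + p ⟨i, h⟩ else n - 1

/-- The weights of the hard instance. -/
def hiddenWeight (n : ℕ) {k m : ℕ} (p : Fin k → Fin m) (i : ℕ) (x : Fin n) : ℕ :=
  if x.val = special n p i then 2 * k - i
  else if x.val / m ≤ i ∧ x.val / m < k ∧ x.val ≠ special n p (x.val / m) then 1 else 0

/-- The objective function of the hard instance. -/
def hiddenObjective (n : ℕ) {k m : ℕ} (p : Fin k → Fin m) (S : Finset (Fin n)) : ℕ :=
  truncatedSum (2 * k) (hiddenWeight n p) S

section Hidden

variable {n k m : ℕ}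

theorem special_of_lt (n : ℕ) (p : Fin k → Fin m) {i : ℕ} (h : i < k) :
    special n p i = i * m + p ⟨i, h⟩ := dif_pos h

theorem special_of_le (n : ℕ) (p : Fin k → Fin m) {i : ℕ} (h : k ≤ i) :
    special n p i = n - 1 := dif_neg (not_lt.mpr h)

theorem special_div (n : ℕ) (p : Fin k → Fin m) {i : ℕ} (h : i < k) :
    special n p i / m = i := by
  have hp := (p ⟨i, h⟩).isLt
  rw [special_of_lt n p h, mul_comm, Nat.mul_add_div (by omega), Nat.div_eq_of_lt hp, add_zero]

theorem le_special (hn : k * m < n) (p : Fin k → Fin m) {i j : ℕ} (hi : i < k) (hij : i < j) :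
    (i + 1) * m ≤ special n p j := by
  rcases lt_or_ge j k with hj | hj
  · rw [special_of_lt n p hj]
    exact le_add_right (Nat.mul_le_mul_right m hij)
  · rw [special_of_le n p hj]
    have := Nat.mul_le_mul_right m (show i + 1 ≤ k from hi)
    omega

theorem special_lt (hn : k * m < n) (p : Fin k → Fin m) (i : ℕ) : special n p i < n := by
  rcases lt_or_ge i k with hi | hi
  · have h1 := (p ⟨i, hi⟩).isLt
    have h2 := Nat.mul_le_mul_right m (show i + 1 ≤ k from hi)
    rw [special_of_lt n p hi]
    rw [Nat.add_mul, one_mul] at h2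
    omega
  · rw [special_of_le n p hi]
    omega

theorem special_update_of_ne (n : ℕ) (p : Fin k → Fin m) (i : Fin k) (v : Fin m) {j : ℕ}
    (h : j ≠ i) : special n (Function.update p i v) j = special n p j := by
  unfold special
  split_ifs with hj
  · rw [Function.update_of_ne fun h' => h (congrArg Fin.val h')]
  · rfl

theorem hiddenWeight_update_of_lt (n : ℕ) (p : Fin k → Fin m) (i : Fin k) (v : Fin m) {j : ℕ}
    (h : j < i) (x : Fin n) :
    hiddenWeight n (Function.update p i v) j x = hiddenWeight n p j x := by
  unfold hiddenWeight
  rw [special_update_of_ne n p i v h.ne]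
  by_cases hx : x.val / m ≤ j
  · rw [special_update_of_ne n p i v (by omega)]
  · simp [hx]

/-- The elements of the blocks up to `i`, other than the special ones of the blocks before `i`. -/
def ordinaryWeight (n : ℕ) (p : Fin k → Fin m) (i : ℕ) (x : Fin n) : ℕ :=
  if x.val / m < i → x.val ≠ special n p (x.val / m) then 1 else 0

theorem ordinaryWeight_update (n : ℕ) (p : Fin k → Fin m) (i : Fin k) (v : Fin m) (x : Fin n) :
    ordinaryWeight n (Function.update p i v) i x = ordinaryWeight n p i x := by
  unfold ordinaryWeight
  by_cases hx : x.val / m < i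
  · rw [special_update_of_ne n p i v hx.ne]
  · simp [hx]

/-- Once the special element of block `i` is set aside, all terms from `i` on see the first `i + 1`
blocks through one and the same weight. -/
theorem hiddenWeight_eq_ordinaryWeight (hn : k * m < n) (p : Fin k → Fin m) {i j : ℕ}
    (hi : i < k) (hij : i ≤ j) {x : Fin n} (hx : x.val < (i + 1) * m)
    (hne : x.val ≠ special n p i) : hiddenWeight n p j x = ordinaryWeight n p i x := by
  have hdiv : x.val / m < i + 1 := Nat.div_lt_of_lt_mul (by rwa [mul_comm])
  have hj : x.val ≠ special n p j := by
    rcases hij.eq_or_lt with rfl | hlt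
    · exact hne
    · have := le_special hn p hi hlt
      omega
  unfold hiddenWeight ordinaryWeight
  rw [if_neg hj]
  refine if_congr ⟨fun h _ => h.2.2, fun h => ⟨by omega, by omega, ?_⟩⟩ rfl rfl
  rcases (Nat.lt_succ_iff.mp hdiv).eq_or_lt with h' | h'
  · rwa [h']
  · exact h h'

/-- On the first `i + 1` blocks, special and ordinary elements of block `i` look alike. -/
theorem hiddenObjective_eq (hn : k * m < n) (p : Fin k → Fin m) {i : ℕ} (hi : i < k)
    {S : Finset (Fin n)} (hS : ∀ x ∈ S, x.val < (i + 1) * m) :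
    hiddenObjective n p S = ∑ j ∈ Finset.range i, min (2 * k - j) (∑ x ∈ S, hiddenWeight n p j x) +
      ∑ j ∈ Finset.range (2 * k - i), min (2 * k - i - j) (∑ x ∈ S, ordinaryWeight n p i x) := by
  unfold hiddenObjective truncatedSum
  rw [← Finset.sum_range_add_sum_Ico _ (show i ≤ 2 * k by omega), Finset.sum_Ico_eq_sum_range]
  congr 1
  by_cases ho : (⟨special n p i, special_lt hn p i⟩ : Fin n) ∈ S
  · set o : Fin n := ⟨special n p i, special_lt hn p i⟩ with ho_def
    have key : ∀ j, i ≤ j → ∑ x ∈ S.erase o, hiddenWeight n p j x =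
        ∑ x ∈ S.erase o, ordinaryWeight n p i x := fun j hj =>
      Finset.sum_congr rfl fun x hx => hiddenWeight_eq_ordinaryWeight hn p hi hj
        (hS x (Finset.mem_of_mem_erase hx)) fun h => Finset.ne_of_mem_erase hx (Fin.ext h)
    have hdiv : o.val / m = i := special_div n p hi
    have h1 : ordinaryWeight n p i o = 1 := by
      unfold ordinaryWeight
      rw [if_pos fun h => absurd h (by omega)]
    -- The element `o` saturates term `i` at `M + 1` and weighs nothing in the later terms, which is
    -- the right side of `sum_min_add_one`.
    obtain ⟨M, hM⟩ : ∃ M, 2 * k - i = M + 1 := ⟨2 * k - i - 1, by omega⟩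
    rw [← Finset.add_sum_erase S (ordinaryWeight n p i) ho, h1, hM, add_comm 1, sum_min_add_one,
      Finset.sum_range_succ', add_comm]
    congr 1
    · have h2 : hiddenWeight n p i o = 2 * k - i := if_pos rfl
      rw [add_zero, ← Finset.add_sum_erase S _ ho, h2]
      omega
    · refine Finset.sum_congr rfl fun j _ => ?_
      have h3 : hiddenWeight n p (i + (j + 1)) o = 0 := by
        have := le_special hn p hi (show i < i + (j + 1) by omega)
        have := hS o ho
        unfold hiddenWeight
        rw [if_neg (by omega), if_neg]
        rw [hdiv]
        exact fun h => h.2.2 rfl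
      rw [← Finset.add_sum_erase S _ ho, h3, key _ (by omega), zero_add]
      congr 1
      omega
  · refine Finset.sum_congr rfl fun j _ => ?_
    rw [Finset.sum_congr rfl fun x hx => hiddenWeight_eq_ordinaryWeight hn p hi
      (Nat.le_add_right i j) (hS x hx) fun h =>
        ho ((show x = ⟨special n p i, special_lt hn p i⟩ from Fin.ext h) ▸ hx)]
    congr 1
    omega

theorem hiddenObjective_update (hn : k * m < n) (p : Fin k → Fin m) (i : Fin k) (v : Fin m)
    {S : Finset (Fin n)} (hS : ∀ x ∈ S, x.val < (i.val + 1) * m) :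
    hiddenObjective n (Function.update p i v) S = hiddenObjective n p S := by
  rw [hiddenObjective_eq hn _ i.isLt hS, hiddenObjective_eq hn p i.isLt hS]
  simp_rw [ordinaryWeight_update]
  congr 1
  refine Finset.sum_congr rfl fun j hj => ?_
  simp_rw [hiddenWeight_update_of_lt n p i v (Finset.mem_range.mp hj)]

/-! ### Optimal and achievable values on the hard instances. -/

theorem blockClass_surjective (hm : 0 < m) (hn : k * m < n) :
    Function.Surjective (blockClass n k m) := by
  intro c
  have hc : c.val * m ≤ k * m := Nat.mul_le_mul_right m (Nat.lt_succ_iff.mp c.isLt)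
  refine ⟨⟨c.val * m, by omega⟩, Fin.ext ?_⟩
  have := c.isLt
  simp only [blockClass, Nat.mul_div_cancel _ hm]
  omega

theorem sum_range_two_mul_sub (k : ℕ) :
    ∑ i ∈ Finset.range (2 * k), (2 * k - i) = k * (2 * k + 1) := by
  have h := Finset.sum_range_reflect (fun i => i + 1) (2 * k)
  have h' : ∑ i ∈ Finset.range (2 * k), (2 * k - i) =
      ∑ i ∈ Finset.range (2 * k), (2 * k - 1 - i + 1) :=
    Finset.sum_congr rfl fun i hi => by
      rw [Finset.mem_range] at hi
      omega
  have h2 := Finset.sum_range_id_mul_two (2 * k + 1)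
  rw [Finset.sum_range_succ'] at h2
  rw [h', h]
  simp only [add_zero, Nat.add_sub_cancel] at h2
  nlinarith

theorem exists_indep_hiddenObjective_eq (hn : k * m < n) (p : Fin k → Fin m) :
    ∃ T, PartitionIndep (blockClass n k m) T ∧ hiddenObjective n p T = k * (2 * k + 1) := by
  rcases Nat.eq_zero_or_pos k with rfl | hk
  · exact ⟨∅, fun x hx => absurd hx (Finset.notMem_empty x),
      by simp [hiddenObjective, truncatedSum]⟩
  have hm : 0 < m := (Nat.zero_le _).trans_lt (p ⟨0, hk⟩).isLt
  let o : ℕ → Fin n := fun i => ⟨special n p i, special_lt hn p i⟩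
  have hlast : k ≤ (n - 1) / m := (Nat.le_div_iff_mul_le hm).mpr (by omega)
  have hclass : ∀ i ≤ k, (blockClass n k m (o i)).val = i := by
    intro i hi
    rcases hi.eq_or_lt with rfl | hi
    · simpa [blockClass, o, special_of_le n p le_rfl] using hlast
    · simp only [blockClass, o, special_div n p hi]
      omega
  refine ⟨(Finset.range (k + 1)).image o, ?_, ?_⟩
  · intro x hx y hy hxy
    obtain ⟨i, hi, rfl⟩ := Finset.mem_image.mp hx
    obtain ⟨j, hj, rfl⟩ := Finset.mem_image.mp hy
    rw [Finset.mem_range, Nat.lt_succ_iff] at hi hj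
    rw [← hclass i hi, ← hclass j hj, hxy]
  · rw [← sum_range_two_mul_sub]
    unfold hiddenObjective truncatedSum
    refine Finset.sum_congr rfl fun i _ => min_eq_left ?_
    have hmem : o i ∈ (Finset.range (k + 1)).image o := by
      -- All terms with index at least `k` are saturated by the same last element.
      refine Finset.mem_image.mpr ⟨min i k, Finset.mem_range.mpr (by omega), Fin.ext ?_⟩
      rcases le_total i k with h | h
      · rw [min_eq_left h]
      · simp only [o, min_eq_right h, special_of_le n p h, special_of_le n p le_rfl]
    have hw : hiddenWeight n p i (o i) = 2 * k - i := if_pos rfl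
    exact hw.symm.le.trans (Finset.single_le_sum
      (f := hiddenWeight n p i) (fun _ _ => Nat.zero_le _) hmem)

theorem sum_range_add_sum_range (k : ℕ) :
    ∑ i ∈ Finset.range k, (i + 1) + ∑ i ∈ Finset.range k, (k - i) = k * (k + 1) := by
  rw [← Finset.sum_add_distrib, Finset.sum_congr rfl (g := fun _ => k + 1)]
  · simp
  · intro i hi
    rw [Finset.mem_range] at hi
    omega

/-- Without its special element, term `i < k` only counts elements of blocks `0, …, i`, at most one
from each; with it, truncation costs at most `2 * k`. The last `k` terms are bounded by their
truncation levels. -/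
theorem hiddenObjective_le (p : Fin k → Fin m) {T : Finset (Fin n)}
    (hT : PartitionIndep (blockClass n k m) T) :
    hiddenObjective n p T ≤ k * (k + 1) +
      2 * k * ∑ i : Fin k, if ∃ x ∈ T, x.val = special n p i then 1 else 0 := by
  have hsplit : hiddenObjective n p T =
      ∑ i ∈ Finset.range k, min (2 * k - i) (∑ x ∈ T, hiddenWeight n p i x)
      + ∑ i ∈ Finset.range k, min (k - i) (∑ x ∈ T, hiddenWeight n p (k + i) x) := by
    unfold hiddenObjective truncatedSum
    rw [two_mul, Finset.sum_range_add]
    congr 1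
    refine Finset.sum_congr rfl fun i _ => ?_
    congr 1
    omega
  have hfirst : ∀ i ∈ Finset.range k, min (2 * k - i) (∑ x ∈ T, hiddenWeight n p i x) ≤
      (i + 1) + 2 * k * if ∃ x ∈ T, x.val = special n p i then 1 else 0 := by
    intro i hi
    rw [Finset.mem_range] at hi
    split_ifs with h
    · omega
    · refine (min_le_right _ _).trans ?_
      have hw : ∀ x ∈ T, hiddenWeight n p i x ≤ if x.val / m ≤ i then 1 else 0 := by
        intro x hx
        have hne : x.val ≠ special n p i := fun h' => h ⟨x, hx, h'⟩
        unfold hiddenWeight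
        rw [if_neg hne]
        split_ifs <;> omega
      refine (Finset.sum_le_sum hw).trans ?_
      rw [← Finset.card_filter, mul_zero, add_zero, ← Finset.card_range (i + 1)]
      refine Finset.card_le_card_of_injOn (fun x => x.val / m) ?_ ?_
      · intro x hx
        have := (Finset.mem_filter.mp hx).2
        simp only [Finset.coe_range, Set.mem_Iio]
        omega
      · intro x hx y hy hxy
        have hx' := Finset.mem_filter.mp hx
        have hy' := Finset.mem_filter.mp hy
        refine hT x hx'.1 y hy'.1 (Fin.ext ?_)
        simp only [blockClass]
        dsimp only at hxy
        rw [hxy]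
  have hsecond : ∑ i ∈ Finset.range k, min (k - i) (∑ x ∈ T, hiddenWeight n p (k + i) x) ≤
      ∑ i ∈ Finset.range k, (k - i) := Finset.sum_le_sum fun _ _ => min_le_left _ _
  have hsum := Finset.sum_le_sum hfirst
  rw [Finset.sum_add_distrib, ← Finset.mul_sum] at hsum
  rw [Fin.sum_univ_eq_sum_range
    (fun i => if ∃ x ∈ T, x.val = special n p i then 1 else 0) k, hsplit,
    ← sum_range_add_sum_range]
  omega

end Hidden

/-! ### Runs of streaming algorithms -/

namespace StreamingAlgorithm

variable {n K : ℕ} {W : Type*}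

theorem state_succ (A : StreamingAlgorithm n K W) (χ : Fin n → Fin K)
    (f : Finset (Fin n) → ℝ) {t : ℕ} (h : t < n) :
    A.state χ f (t + 1) =
      (A.keep χ ⟨t, h⟩ (A.state χ f t).1 (A.state χ f t).2
          (visible f (insert ⟨t, h⟩ (A.state χ f t).1)),
        A.write χ ⟨t, h⟩ (A.state χ f t).1 (A.state χ f t).2
          (visible f (insert ⟨t, h⟩ (A.state χ f t).1))) := by
  rw [state, dif_pos h]

theorem state_succ_of_le (A : StreamingAlgorithm n K W) (χ : Fin n → Fin K)
    (f : Finset (Fin n) → ℝ) {t : ℕ} (h : n ≤ t) :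
    A.state χ f (t + 1) = A.state χ f t := by
  rw [state, dif_neg (not_lt.mpr h)]

theorem mem_state_succ (A : StreamingAlgorithm n K W) (χ : Fin n → Fin K)
    (f : Finset (Fin n) → ℝ) {t : ℕ} {x : Fin n} (hx : x ∈ (A.state χ f (t + 1)).1) :
    x.val = t ∨ x ∈ (A.state χ f t).1 := by
  rcases lt_or_ge t n with h | h
  · rw [state_succ A χ f h] at hx
    rcases Finset.mem_insert.mp (A.keep_subset _ _ _ _ _ hx) with h' | h'
    · exact Or.inl (congrArg Fin.val h')
    · exact Or.inr h'
  · rw [state_succ_of_le A χ f h] at hx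
    exact Or.inr hx

theorem lt_of_mem_state (A : StreamingAlgorithm n K W) (χ : Fin n → Fin K)
    (f : Finset (Fin n) → ℝ) {t : ℕ} {x : Fin n} (hx : x ∈ (A.state χ f t).1) : x.val < t := by
  induction t with
  | zero => exact absurd hx (Finset.notMem_empty x)
  | succ t ih =>
    rcases mem_state_succ A χ f hx with h | h
    · omega
    · exact (ih h).trans t.lt_succ_self

theorem mem_state_of_le (A : StreamingAlgorithm n K W) (χ : Fin n → Fin K)
    (f : Finset (Fin n) → ℝ) {t u : ℕ} (htu : t ≤ u) {x : Fin n} (hxt : x.val < t)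
    (hx : x ∈ (A.state χ f u).1) : x ∈ (A.state χ f t).1 := by
  induction u, htu using Nat.le_induction with
  | base => exact hx
  | succ u hu ih =>
    rcases mem_state_succ A χ f hx with h | h
    · omega
    · exact ih h

/-- Up to time `u` only values on sets of already arrived elements are visible. -/
theorem state_congr (A : StreamingAlgorithm n K W) (χ : Fin n → Fin K)
    {f g : Finset (Fin n) → ℝ} {u : ℕ}
    (hfg : ∀ S : Finset (Fin n), (∀ x ∈ S, x.val < u) → f S = g S) {t : ℕ} (ht : t ≤ u) :
    A.state χ f t = A.state χ g t := by
  induction t with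
  | zero => rfl
  | succ t ih =>
    have ih := ih (Nat.le_of_succ_le ht)
    rcases lt_or_ge t n with h | h
    · have hv : visible f (insert ⟨t, h⟩ (A.state χ g t).1) =
          visible g (insert ⟨t, h⟩ (A.state χ g t).1) := by
        funext S
        unfold visible
        split_ifs with hS
        · refine hfg S fun x hx => ?_
          rcases Finset.mem_insert.mp (hS hx) with h' | h'
          · rw [h']
            exact ht
          · have := lt_of_mem_state A χ g h'
            omega
        · rfl
      rw [state_succ A χ f h, state_succ A χ g h, ih, hv]
    · rw [state_succ_of_le A χ f h, state_succ_of_le A χ g h, ih]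

theorem card_state_le_space (A : StreamingAlgorithm n K W) (χ : Fin n → Fin K)
    (f : Finset (Fin n) → ℝ) {t : ℕ} (ht : t ≤ n) : (A.state χ f t).1.card ≤ A.space χ f :=
  le_add_left (Finset.le_sup (f := fun t => (A.state χ f t).1.card)
    (Finset.mem_range.mpr (Nat.lt_succ_of_le ht)))

end StreamingAlgorithm

/-! ### Averaging over the hidden elements -/

/-- Resampling one coordinate preserves the uniform distribution: swapping the `i`-th coordinate of
`p` with `v` is an involution on pairs. -/
theorem sum_sum_update {ι V : Type*} [Fintype ι] [DecidableEq ι] [Fintype V]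
    (i : ι) (F : (ι → V) → ℕ) :
    ∑ p : ι → V, ∑ v : V, F (Function.update p i v) = Fintype.card V * ∑ p, F p := by
  let e : (ι → V) × V ≃ (ι → V) × V :=
    Function.Involutive.toPerm (fun q => (Function.update q.1 i q.2, q.1 i)) fun q => by simp
  rw [← Fintype.sum_prod_type', show ∑ q : (ι → V) × V, F (Function.update q.1 i q.2) =
      ∑ q : (ι → V) × V, F q.1 from
    Equiv.sum_comp e fun q => F q.1, Fintype.sum_prod_type]
  simp [Finset.mul_sum]

/-- A deterministic algorithm which uses space `s` outputs the special element of block `i` on at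
most an `s / m` fraction of the hard instances. -/
theorem card_special_mem_result_le {n k m s : ℕ} {W : Type*} (hn : k * m < n)
    (A : StreamingAlgorithm n (k + 1) W) (χ : Fin n → Fin (k + 1))
    (hs : ∀ p : Fin k → Fin m, A.space χ (fun S => (hiddenObjective n p S : ℝ)) ≤ s) (i : Fin k) :
    m * ∑ p : Fin k → Fin m, (if ∃ x ∈ A.result χ (fun S => (hiddenObjective n p S : ℝ)),
      x.val = special n p i then 1 else 0) ≤ m ^ k * s := by
  have hend : (i.val + 1) * m ≤ n :=
    (Nat.mul_le_mul_right m (show i.val + 1 ≤ k from i.isLt)).trans hn.le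
  have h := sum_sum_update i fun p : Fin k → Fin m =>
    if ∃ x ∈ A.result χ (fun S => (hiddenObjective n p S : ℝ)), x.val = special n p i then 1 else 0
  rw [Fintype.card_fin] at h
  rw [← h]
  have hcard : m ^ k * s = ∑ _p : Fin k → Fin m, s := by simp
  rw [hcard]
  refine Finset.sum_le_sum fun p _ => ?_
  refine le_trans ?_
    ((A.card_state_le_space χ (fun S => (hiddenObjective n p S : ℝ)) hend).trans (hs p))
  rw [← Finset.card_filter]
  refine Finset.card_le_card_of_injOn
    (fun v => ⟨special n (Function.update p i v) i, special_lt hn _ _⟩) ?_ ?_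
  · intro v hv
    obtain ⟨x, hx, hxv⟩ := (Finset.mem_filter.mp hv).2
    have hxlt : x.val < (i.val + 1) * m := by
      rw [hxv, special_of_lt n _ i.isLt, Nat.add_mul, one_mul]
      exact Nat.add_lt_add_left (Fin.isLt _) _
    have hmem := A.mem_state_of_le χ _ hend hxlt (A.output_subset _ _ _ _ hx)
    -- The stored set at the end of block `i` is now the same for all `v`, so it contains the
    -- special element for every successful `v`.
    rw [A.state_congr χ (fun S hS => by rw [hiddenObjective_update hn p i v hS]) le_rfl] at hmem
    obtain rfl : x = ⟨special n (Function.update p i v) i, special_lt hn _ _⟩ := Fin.ext hxv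
    exact hmem
  · intro v _ w _ hvw
    have := congrArg Fin.val hvw
    simp only [special_of_lt n _ i.isLt, Fin.eta, Function.update_self] at this
    exact Fin.ext (by omega)

theorem sum_hiddenObjective_result_le {n k m s : ℕ} {W : Type*} (hn : k * m < n)
    (A : StreamingAlgorithm n (k + 1) W)
    (hT : ∀ p : Fin k → Fin m, PartitionIndep (blockClass n k m)
      (A.result (blockClass n k m) fun S => (hiddenObjective n p S : ℝ)))
    (hs : ∀ p : Fin k → Fin m, A.space (blockClass n k m)
      (fun S => (hiddenObjective n p S : ℝ)) ≤ s) :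
    m * ∑ p : Fin k → Fin m,
        hiddenObjective n p (A.result (blockClass n k m) fun S => (hiddenObjective n p S : ℝ)) ≤
      m ^ k * (m * (k * (k + 1)) + 2 * k * (k * s)) := by
  have h1 := Finset.sum_le_sum fun p (_ : p ∈ Finset.univ) => hiddenObjective_le p (hT p)
  rw [Finset.sum_add_distrib, ← Finset.mul_sum (a := 2 * k), Finset.sum_comm] at h1
  have h2 := Finset.sum_le_sum fun i (_ : i ∈ Finset.univ) =>
    card_special_mem_result_le hn A (blockClass n k m) hs i
  rw [← Finset.mul_sum] at h2
  simp only [Finset.sum_const, Finset.card_univ, Fintype.card_fin, Fintype.card_pi,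
    Finset.prod_const, smul_eq_mul] at h1 h2
  refine (Nat.mul_le_mul_left m h1).trans ?_
  have h3 := Nat.mul_le_mul_left (2 * k) h2
  rw [mul_add, mul_left_comm m (2 * k)]
  refine (Nat.add_le_add_left h3 _).trans (le_of_eq ?_)
  ring

/-- An approximation ratio of `(k + 1) / (2 k + 1) + ε` requires space `ε m` if there are `k` blocks
of length `m`. -/
theorem mul_le_of_hasApproxRatio {n k m s : ℕ} {ε : ℝ} (hk : 0 < k) (hm : 0 < m)
    (hn : k * m < n) {W Ω : Type*} [MeasurableSpace Ω] (μ : Measure Ω) [IsProbabilityMeasure μ]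
    (A : Ω → StreamingAlgorithm n (k + 1) W)
    (hA : HasApproxRatio μ A (((k : ℝ) + 1) / (2 * k + 1) + ε)) (hs : UsesSpaceAtMost μ A s) :
    ε * m ≤ s := by
  set χ := blockClass n k m
  set r : Ω → (Fin k → Fin m) → Finset (Fin n) :=
    fun ω p => (A ω).result χ fun S => (hiddenObjective n p S : ℝ)
  have hinst : ∀ p : Fin k → Fin m, IsInstance χ fun S => (hiddenObjective n p S : ℝ) := fun p =>
    isInstance_truncatedSum (blockClass_surjective hm hn) _ _
  have hint : ∀ p, Integrable (fun ω => (hiddenObjective n p (r ω p) : ℝ)) μ := fun p =>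
    (hA χ _ (hinst p)).2.1
  have hlower : ∀ p : Fin k → Fin m, (((k : ℝ) + 1) / (2 * k + 1) + ε) * (k * (2 * k + 1)) ≤
      ∫ ω, (hiddenObjective n p (r ω p) : ℝ) ∂μ := by
    intro p
    obtain ⟨T, hT, hval⟩ := exists_indep_hiddenObjective_eq hn p
    have := (hA χ _ (hinst p)).2.2 T hT
    simp only [hval] at this
    exact_mod_cast this
  have hupper : ∀ᵐ ω ∂μ, (m : ℝ) * ∑ p, (hiddenObjective n p (r ω p) : ℝ) ≤
      (m : ℝ) ^ k * (m * (k * (k + 1)) + 2 * k * (k * s)) := by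
    -- There are finitely many `p`, so almost every seed is feasible and within space on all hard
    -- instances at once.
    filter_upwards [ae_all_iff.mpr fun p => (hA χ _ (hinst p)).1,
      ae_all_iff.mpr fun p => hs χ _ (hinst p)] with ω h1 h2
    exact_mod_cast sum_hiddenObjective_result_le hn (A ω) h1 h2
  have hmean : ∫ ω, (m : ℝ) * ∑ p, (hiddenObjective n p (r ω p) : ℝ) ∂μ ≤
      (m : ℝ) ^ k * (m * (k * (k + 1)) + 2 * k * (k * s)) := by
    have := integral_mono_ae ((integrable_finsetSum _ fun p _ => hint p).const_mul (m : ℝ))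
      (integrable_const _) hupper
    simpa using this
  rw [integral_const_mul, integral_finsetSum _ fun p _ => hint p] at hmean
  have hsum := Finset.sum_le_sum fun p (_ : p ∈ Finset.univ) => hlower p
  simp only [Finset.sum_const, Finset.card_univ, Fintype.card_fin, Fintype.card_pi,
    Finset.prod_const, nsmul_eq_mul, Nat.cast_pow] at hsum
  have hk' : (0 : ℝ) < k := Nat.cast_pos.mpr hk
  have hm' : (0 : ℝ) < m := Nat.cast_pos.mpr hm
  have hle := (mul_le_mul_of_nonneg_left hsum hm'.le).trans hmean
  rw [mul_left_comm] at hle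
  have hle := le_of_mul_le_mul_left hle (pow_pos hm' k)
  have hexpand : (((k : ℝ) + 1) / (2 * k + 1) + ε) * (k * (2 * k + 1)) =
      k * (k + 1) + ε * (k * (2 * k + 1)) := by
    field_simp
  rw [hexpand] at hle
  have hle : k * (ε * m * (2 * k + 1)) ≤ k * ((s : ℝ) * (2 * k)) := by linarith
  have hle := le_of_mul_le_mul_left hle hk'
  have hle : ε * m * (2 * k + 1) ≤ s * (2 * k + 1) := by
    have : (0 : ℝ) ≤ s := Nat.cast_nonneg s
    linarith
  exact le_of_mul_le_mul_right hle (by positivity)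

/-! ### The rank-one case and the choice of the block length. -/

theorem not_hasApproxRatio_of_one_lt {n K : ℕ} {α : ℝ} (hα : 1 < α) (hK : 1 ≤ K) (hKn : K ≤ n)
    {W Ω : Type*} [MeasurableSpace Ω] (μ : Measure Ω) [IsProbabilityMeasure μ]
    (A : Ω → StreamingAlgorithm n K W) : ¬ HasApproxRatio μ A α := by
  intro hA
  let χ : Fin n → Fin K := fun x => ⟨min x.val (K - 1), by omega⟩
  have hχ : Function.Surjective χ := fun c =>
    ⟨⟨c.val, by omega⟩, Fin.ext (min_eq_left (Nat.le_sub_one_of_lt c.isLt))⟩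
  have h := (hA χ (fun _ => 1) ⟨hχ, fun _ => zero_le_one, fun _ _ _ => le_rfl,
    fun _ _ _ _ _ => le_rfl⟩).2.2 ∅ fun x hx => absurd hx (Finset.notMem_empty x)
  simp at h
  linarith

theorem theorem2 (ε : ℝ) (hε : 0 < ε) :
    ∃ c : ℝ, 0 < c ∧
      ∀ (K n : ℕ), 1 ≤ K → K ≤ n →
      ∀ (W : Type*) (Ω : Type*) [MeasurableSpace Ω] (μ : Measure Ω) [IsProbabilityMeasure μ]
        (A : Ω → StreamingAlgorithm n K W),
        HasApproxRatio μ A ((K : ℝ) / (2 * (K : ℝ) - 1) + ε) →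
        ∀ s : ℕ, UsesSpaceAtMost μ A s → c * ((n : ℝ) / (K : ℝ)) ≤ (s : ℝ) := by
  refine ⟨ε / 2, by positivity, ?_⟩
  intro K n hK hKn W Ω _ μ _ A hA s hs
  obtain ⟨k, rfl⟩ : ∃ k, K = k + 1 := ⟨K - 1, by omega⟩
  -- For `K = 1` the required ratio is `1 + ε`, which a constant objective already rules out.
  rcases Nat.eq_zero_or_pos k with rfl | hk
  · refine absurd hA (not_hasApproxRatio_of_one_lt ?_ hK hKn μ A)
    norm_num
    exact hε
  have hm : 0 < (n - 1) / k := Nat.div_pos (by omega) hk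
  have hmul : k * ((n - 1) / k) < n := by
    have := Nat.mul_div_le (n - 1) k
    omega
  have hratio : ((k + 1 : ℕ) : ℝ) / (2 * ((k + 1 : ℕ) : ℝ) - 1) = ((k : ℝ) + 1) / (2 * k + 1) := by
    push_cast
    congr 1
    ring
  rw [hratio] at hA
  have hmain := mul_le_of_hasApproxRatio hk hm hmul μ A hA hs
  -- Rounding down the block length loses at most a factor 2, whence the constant `ε / 2`.
  have hlen : n ≤ 2 * ((n - 1) / k) * (k + 1) := by
    have h := Nat.lt_mul_div_succ (n - 1) hk
    have : n ≤ k * ((n - 1) / k) + k := by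
      rw [Nat.mul_add, mul_one] at h
      omega
    nlinarith
  have hlen' : (n : ℝ) / ((k + 1 : ℕ) : ℝ) ≤ 2 * (((n - 1) / k : ℕ) : ℝ) := by
    rw [div_le_iff₀ (by positivity)]
    exact_mod_cast hlen
  calc ε / 2 * ((n : ℝ) / ((k + 1 : ℕ) : ℝ)) ≤ ε / 2 * (2 * (((n - 1) / k : ℕ) : ℝ)) := by gcongr
    _ = ε * (((n - 1) / k : ℕ) : ℝ) := by ring
    _ ≤ s := hmain
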